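/- \textbf{Definitions.} Let $q>0$ be real, $[i]=\sum_{k=0}^{i-1}q^k$, $[n]!=\prod_{i=1}^n[i]$, $\binom{n}{k}_q=\frac{[n]!}{[k]!\,[n-k]!}$ and $(t;q)_n=\prod_{i=0}^{n-1}(1-tq^i)$. For a tuple $c=(c_1,\dots,c_m)$ of non-negative integers, $\mathrm{MSet}(c)$ is the multiset containing each $i\in\{1,\dots,m\}$ exactly $c_i$ times. A \emph{configuration} is a tuple $c=(c_1,\dots,c_n)$ of non-negative integers with $\sum_i c_i=n$; its balls are the $n$ elements of $\mathrm{MSet}(c)$. The balls are dropped one at a time onto their sites in $\mathbb{Z}$, which is empty at first; a ball on a filled site moves one site left with probability $\frac{q}{1+q}$ and one site right with probability $\frac{1}{1+q}$, independently, until it reaches an empty site, which it fills. The probability $\mathbb{P}(c\to[1;n])_q$ that the final set of filled sites is $[1;n]=\{1,\dots,n\}$ does not depend on the order in which the balls are dropped, and the \emph{remixed Eulerian number} of $c$ is $A_c(q)=[n]!\;\mathbb{P}(c\to[1;n])_q$. The configuration $c$ is \emph{weakly {\L}ukasiewicz} if, when its balls are dropped from left to right (in non-decreasing order of their starting sites),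 in every possible evolution in which all the balls stop, either the set of filled sites is an interval of $\mathbb{Z}$ at all times, or some ball stops outside $[1;n]$. Two power series in $t$ are congruent mod $t^{k+1}$ if their coefficients of $t^i$ agree for all $0\le i\le k$. \textbf{Theorem.} Let $q>0$, and let $\gamma=(\gamma_1,\dots,\gamma_m)$ be a tuple of non-negative integers with $m\ge 1$, $\gamma_1>0$, $\gamma_m>0$ and $\gamma_1+\dots+\gamma_m=n$. Suppose that there is an integer $k$ with $0\le k\le n-m$ for which the configuration $(0^k,\gamma,0^{n-m-k})$ is weakly {\L}ukasiewicz, and let $k$ be the maximal such integer. Then $$\sum_{i=0}^{n-m}t^iA_{(0^i,\gamma,0^{n-m-i})}(q)\equiv (t;q)_{n+1}\sum_{j\ge0}t^j\prod_{a\in\mathrm{MSet}(\gamma)}[j+a]\pmod{t^{k+1}},$$ and $$A_{(0^k,\gamma,0^{n-m-k})}(q)=\sum_{j=0}^{k}(-1)^{j+k}q^{\binom{k-j}{2}}\binom{n+1}{k-j}_q\prod_{a\in\mathrm{MSet}(\gamma)}[j+a].$$ -/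

import Mathlib

open scoped NNReal ENNReal

namespace Remixed

noncomputable section

/-! ### `q`-integers, `q`-factorials, `q`-binomials, `q`-Pochhammer symbols -/

/-- The `q`-integer `[i] = 1 + q + ⋯ + q ^ (i - 1)`. -/
def qInt (q : ℝ) (i : ℕ) : ℝ := ∑ k ∈ Finset.range i, q ^ k

/-- The `q`-factorial `[n]! = [1] [2] ⋯ [n]`. -/
def qFact (q : ℝ) (n : ℕ) : ℝ := ∏ i ∈ Finset.Icc 1 n, qInt q i

/-- The `q`-binomial `[n]! / ([k]! [n-k]!)` for `k ≤ n`, extended by `0` for `k > n`. -/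
def qBinom (q : ℝ) (n k : ℕ) : ℝ :=
  if k ≤ n then qFact q n / (qFact q k * qFact q (n - k)) else 0

/-- The `q`-Pochhammer symbol `(t;q)_n = ∏_{i<n} (1 - t q^i)`, a power series in `t`. -/
def qPochhammer (q : ℝ) (n : ℕ) : PowerSeries ℝ :=
  ∏ i ∈ Finset.range n, (1 - PowerSeries.X * PowerSeries.C (q ^ i))

/-- Two power series are equal mod `t ^ k` if their coefficients of index `i < k` agree. -/
def EqMod (k : ℕ) (f g : PowerSeries ℝ) : Prop :=
  ∀ i < k, PowerSeries.coeff i f = PowerSeries.coeff i g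

/-! ### Configurations

A tuple `(c₁, …, c_m)` of numbers of balls is a list of naturals; the entry at (0-based) list
index `i` is the number of balls at site `i + 1`. -/

/-- A configuration: a tuple `(c₁, …, c_n)` of naturals with `c₁ + ⋯ + c_n = n`. -/
def IsConfiguration (c : List ℕ) : Prop := c.sum = c.length

/-- `MSet(c)`: the multiset containing each site `i ∈ [1;m]` exactly `c_i` times. -/
def MSet (c : List ℕ) : Multiset ℕ :=
  ∑ i : Fin c.length, Multiset.replicate (c.get i) ((i : ℕ) + 1)

/-- The tuple `(0^i, γ, 0^j)`. -/
def pad (i : ℕ) (γ : List ℕ) (j : ℕ) : List ℕ :=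
  List.replicate i 0 ++ γ ++ List.replicate j 0

/-- `γ = (γ₁, …, γ_m)` is a core: `m > 0`, `γ₁ > 0` and `γ_m > 0`. -/
def IsCore (γ : List ℕ) : Prop :=
  ∃ h : γ ≠ [], 0 < γ.head h ∧ 0 < γ.getLast h

/-! ### The particle model

A state `(S, u)` consists of the set `S ⊆ ℤ` of sites filled so far, and of the list `u` of the
balls that still have to be dropped, in dropping order.  The head of `u` is the ball being dropped,
recorded by its current site. -/

/-- A state of the particle model. -/
abbrev State : Type := Finset ℤ × List ℤ

/-- The coin deciding the direction of a bounce: `true` (left) with probability `q / (1 + q)`,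
`false` (right) with probability `1 / (1 + q)`. -/
def coin (q : ℝ≥0) : PMF Bool :=
  PMF.ofFintype (fun b => ((cond b (q / (1 + q)) (1 / (1 + q)) : ℝ≥0) : ℝ≥0∞)) (by
    have h : q / (1 + q) + 1 / (1 + q) = 1 := by
      rw [← add_div, add_comm q 1]
      exact div_self (by positivity)
    rw [Fintype.sum_bool]
    exact_mod_cast h)

/-- One move.  If no ball is left, nothing happens.  If the current ball is on a hole, it stops
there.  If it is on a filled site, it moves one site left or right, according to the coin `b`. -/
def move (b : Bool) : State → State
  | (S, []) => (S, [])
  | (S, x :: u) =>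
      if x ∈ S then (S, (cond b (x - 1) (x + 1)) :: u) else (insert x S, u)

/-- The law of the state after `N` moves, with independent coins. -/
def law (q : ℝ≥0) : ℕ → State → PMF State
  | 0, s => PMF.pure s
  | N + 1, s => (coin q).bind fun b => law q N (move b s)

/-- The probability that, starting from the state `s`, at some time all balls have stopped and the
filled set is `T`.  As states without remaining balls never change again, this is the supremum
(and the limit) over `N` of the probability of being in the state `(T, [])` after `N` moves. -/
def finalProb (q : ℝ≥0) (T : Finset ℤ) (s : State) : ℝ≥0∞ :=
  ⨆ N : ℕ, law q N s (T, [])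

/-! The probability `finalProb` does not depend on the order in which the balls are dropped.  This
is proved now, since it makes the probability attached to a configuration well defined. -/

theorem law_succ_apply (q : ℝ≥0) (N : ℕ) (s t : State) :
    law q (N + 1) s t =
      ((q / (1 + q) : ℝ≥0) : ℝ≥0∞) * law q N (move true s) t +
        ((1 / (1 + q) : ℝ≥0) : ℝ≥0∞) * law q N (move false s) t := by
  simp only [law, PMF.bind_apply, tsum_fintype, Fintype.sum_bool]
  rfl

theorem coin_add (q : ℝ≥0) :
    ((q / (1 + q) : ℝ≥0) : ℝ≥0∞) + ((1 / (1 + q) : ℝ≥0) : ℝ≥0∞) = 1 := by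
  have h : q / (1 + q) + 1 / (1 + q) = 1 := by
    rw [← add_div, add_comm q 1]
    exact div_self (by positivity)
  exact_mod_cast h

theorem law_nil (q : ℝ≥0) (N : ℕ) (S : Finset ℤ) (t : State) :
    law q N (S, []) t = if t = (S, []) then 1 else 0 := by
  induction N with
  | zero => simp [law, PMF.pure_apply]
  | succ N ih => rw [law_succ_apply, move, move, ih, ← add_mul, coin_add, one_mul]

theorem law_mono_succ (q : ℝ≥0) (T : Finset ℤ) (N : ℕ) (s : State) :
    law q N s (T, []) ≤ law q (N + 1) s (T, []) := by
  induction N generalizing s with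
  | zero =>
    obtain ⟨S, u⟩ := s
    cases u with
    | nil => rw [law_nil, law_nil]
    | cons x u => simp [law, PMF.pure_apply]
  | succ N ih =>
    rw [law_succ_apply, law_succ_apply q (N + 1)]
    gcongr <;> exact ih _

theorem law_mono (q : ℝ≥0) (T : Finset ℤ) (s : State) :
    Monotone fun N => law q N s (T, []) :=
  monotone_nat_of_le_succ fun N => law_mono_succ q T N s

theorem finalProb_le_one (q : ℝ≥0) (T : Finset ℤ) (s : State) : finalProb q T s ≤ 1 :=
  iSup_le fun _ => PMF.coe_le_one _ _

/-- One-step analysis of `finalProb`. -/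
theorem finalProb_step (q : ℝ≥0) (T : Finset ℤ) (s : State) :
    finalProb q T s =
      ((q / (1 + q) : ℝ≥0) : ℝ≥0∞) * finalProb q T (move true s) +
        ((1 / (1 + q) : ℝ≥0) : ℝ≥0∞) * finalProb q T (move false s) := by
  have h1 : finalProb q T s = ⨆ N : ℕ, law q (N + 1) s (T, []) :=
    ((law_mono q T s).iSup_nat_add 1).symm
  rw [h1]
  simp only [finalProb, ENNReal.mul_iSup, law_succ_apply]
  rw [ENNReal.iSup_add_iSup_of_monotone]
  · intro a b hab
    dsimp only
    gcongr
    exact law_mono q T _ hab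
  · intro a b hab
    dsimp only
    gcongr
    exact law_mono q T _ hab

theorem finalProb_nil (q : ℝ≥0) (T S : Finset ℤ) :
    finalProb q T (S, []) = if T = S then 1 else 0 := by
  simp [finalProb, law_nil]

theorem finalProb_hole (q : ℝ≥0) (T S : Finset ℤ) {x : ℤ} (u : List ℤ) (hx : x ∉ S) :
    finalProb q T (S, x :: u) = finalProb q T (insert x S, u) := by
  rw [finalProb_step]
  simp only [move, hx, if_false]
  rw [← add_mul, coin_add, one_mul]

theorem finalProb_bounce (q : ℝ≥0) (T S : Finset ℤ) {x : ℤ} (u : List ℤ) (hx : x ∈ S) :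
    (finalProb q T (S, x :: u)).toReal =
      (q / (1 + q) : ℝ) * (finalProb q T (S, (x - 1) :: u)).toReal +
        (1 / (1 + q) : ℝ) * (finalProb q T (S, (x + 1) :: u)).toReal := by
  have hne : ∀ s, finalProb q T s ≠ ∞ := fun s =>
    ne_top_of_le_ne_top ENNReal.one_ne_top (finalProb_le_one q T s)
  rw [finalProb_step]
  simp only [move, hx, if_true, cond_true, cond_false]
  rw [ENNReal.toReal_add (ENNReal.mul_ne_top ENNReal.coe_ne_top (hne _))
    (ENNReal.mul_ne_top ENNReal.coe_ne_top (hne _)), ENNReal.toReal_mul, ENNReal.toReal_mul, ENNReal.coe_toReal, ENNReal.coe_toReal]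
  push_cast
  rfl

/-- Maximum principle: a function that is harmonic on the finite set `S` for the biased walk and
vanishes outside of `S` is nowhere positive. -/
theorem harmonic_nonpos (q : ℝ≥0) (S : Finset ℤ) (g : ℤ → ℝ) (h0 : ∀ x ∉ S, g x = 0)
    (h : ∀ x ∈ S, g x = (q / (1 + q) : ℝ) * g (x - 1) + (1 / (1 + q) : ℝ) * g (x + 1)) (x : ℤ) :
    g x ≤ 0 := by
  by_contra! hx
  have hxS : x ∈ S := by
    by_contra hc
    exact hx.ne' (h0 x hc)
  obtain ⟨y, hyS, hy⟩ := S.exists_max_image g ⟨x, hxS⟩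
  have hgy : 0 < g y := hx.trans_le (hy x hxS)
  have hle : ∀ z, g z ≤ g y := fun z => by
    by_cases hz : z ∈ S
    · exact hy z hz
    · rw [h0 z hz]; exact hgy.le
  obtain ⟨z, hz, hzmax⟩ := (S.filter fun z => g z = g y).exists_max_image id
    ⟨y, Finset.mem_filter.2 ⟨hyS, rfl⟩⟩
  rw [Finset.mem_filter] at hz
  have hq : (0 : ℝ) ≤ q := q.2
  have e1 : (q / (1 + q) : ℝ) + 1 / (1 + q) = 1 := by field_simp; ring
  have e2 : (0 : ℝ) < 1 / (1 + q) := by positivity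
  have e3 : (0 : ℝ) ≤ q / (1 + q) := by positivity
  have hz1 := h z hz.1
  have hnext : g (z + 1) = g y := by
    refine le_antisymm (hle _) ?_
    have h2 := mul_le_mul_of_nonneg_left (hle (z - 1)) e3
    have h3 : (1 / (1 + q) : ℝ) * g y ≤ 1 / (1 + q) * g (z + 1) := by
      have h4 : g y = (q / (1 + q) : ℝ) * g y + 1 / (1 + q) * g y := by rw [← add_mul, e1, one_mul]
      linarith [hz.2]
    exact le_of_mul_le_mul_left h3 e2
  have hmem : z + 1 ∈ S := by
    by_contra hc
    rw [h0 _ hc] at hnext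
    linarith
  have := hzmax (z + 1) (Finset.mem_filter.2 ⟨hmem, hnext⟩)
  simp at this

/-- Two functions that are harmonic on the finite set `S` and agree outside of `S` are equal. -/
theorem harmonic_unique (q : ℝ≥0) (S : Finset ℤ) (f g : ℤ → ℝ) (h0 : ∀ x ∉ S, f x = g x)
    (hf : ∀ x ∈ S, f x = (q / (1 + q) : ℝ) * f (x - 1) + (1 / (1 + q) : ℝ) * f (x + 1))
    (hg : ∀ x ∈ S, g x = (q / (1 + q) : ℝ) * g (x - 1) + (1 / (1 + q) : ℝ) * g (x + 1)) (x : ℤ) :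
    f x = g x := by
  have h1 := harmonic_nonpos q S (fun x => f x - g x) (fun x hx => sub_eq_zero.2 (h0 x hx))
    (fun x hx => by rw [hf x hx, hg x hx]; ring) x
  have h2 := harmonic_nonpos q S (fun x => g x - f x) (fun x hx => sub_eq_zero.2 (h0 x hx).symm)
    (fun x hx => by rw [hf x hx, hg x hx]; ring) x
  linarith

theorem finalProb_bounce_snd (q : ℝ≥0) (T S : Finset ℤ) (x : ℤ) {y : ℤ} (u : List ℤ)
    (hy : y ∈ S) :
    (finalProb q T (S, x :: y :: u)).toReal =
      (q / (1 + q) : ℝ) * (finalProb q T (S, x :: (y - 1) :: u)).toReal +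
        (1 / (1 + q) : ℝ) * (finalProb q T (S, x :: (y + 1) :: u)).toReal := by
  refine harmonic_unique q S (fun x => (finalProb q T (S, x :: y :: u)).toReal)
    (fun x => (q / (1 + q) : ℝ) * (finalProb q T (S, x :: (y - 1) :: u)).toReal +
        (1 / (1 + q) : ℝ) * (finalProb q T (S, x :: (y + 1) :: u)).toReal) ?_ ?_ ?_ x
  · intro x hx
    rw [finalProb_hole q T S _ hx, finalProb_hole q T S _ hx, finalProb_hole q T S _ hx,
      finalProb_bounce q T _ u (Finset.mem_insert_of_mem hy)]
  · intro x hx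
    exact finalProb_bounce q T S _ hx
  · intro x hx
    rw [finalProb_bounce q T S ((y - 1) :: u) hx, finalProb_bounce q T S ((y + 1) :: u) hx]
    ring

theorem finalProb_swap (q : ℝ≥0) (T S : Finset ℤ) (x y : ℤ) (u : List ℤ) :
    (finalProb q T (S, x :: y :: u)).toReal = (finalProb q T (S, y :: x :: u)).toReal := by
  refine harmonic_unique q S (fun x => (finalProb q T (S, x :: y :: u)).toReal)
    (fun x => (finalProb q T (S, y :: x :: u)).toReal) ?_
    (fun x hx => finalProb_bounce q T S _ hx) (fun x hx => finalProb_bounce_snd q T S y u hx) x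
  intro x hx
  refine harmonic_unique q S (fun y => (finalProb q T (S, x :: y :: u)).toReal)
    (fun y => (finalProb q T (S, y :: x :: u)).toReal) ?_
    (fun y hy => finalProb_bounce_snd q T S x u hy) (fun y hy => finalProb_bounce q T S _ hy) y
  intro y hy
  by_cases hxy : x = y
  · rw [hxy]
  · rw [finalProb_hole q T S _ hx, finalProb_hole q T S _ hy,
      finalProb_hole q T _ _ (by simp [hy, Ne.symm hxy]),
      finalProb_hole q T _ _ (by simp [hx, hxy]), Finset.insert_comm]

theorem finalProb_perm (q : ℝ≥0) (T : Finset ℤ) {u v : List ℤ} (h : u.Perm v) (S : Finset ℤ) :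
    finalProb q T (S, u) = finalProb q T (S, v) := by
  have hne : ∀ s, finalProb q T s ≠ ∞ := fun s =>
    ne_top_of_le_ne_top ENNReal.one_ne_top (finalProb_le_one q T s)
  rw [← ENNReal.toReal_eq_toReal_iff' (hne _) (hne _)]
  induction h generalizing S with
  | nil => rfl
  | @cons x u v _ ih =>
    refine harmonic_unique q S (fun x => (finalProb q T (S, x :: u)).toReal)
      (fun x => (finalProb q T (S, x :: v)).toReal) (fun x hx => ?_)
      (fun x hx => finalProb_bounce q T S _ hx) (fun x hx => finalProb_bounce q T S _ hx) x
    rw [finalProb_hole q T S _ hx, finalProb_hole q T S _ hx, ih]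
  | swap x y u => exact finalProb_swap q T S y x u
  | trans _ _ ih1 ih2 => exact (ih1 S).trans (ih2 S)

/-- `ℙ(M → T)_q`: the probability that the final filled set is `T` when the balls of the multiset
`M` of sites are dropped, in any order, onto the empty line `ℤ`. -/
def dropProb (q : ℝ≥0) (M : Multiset ℤ) (T : Finset ℤ) : ℝ≥0∞ :=
  Quotient.liftOn M (fun u => finalProb q T (∅, u)) fun _ _ h => finalProb_perm q T h ∅

/-- The remixed Eulerian number `A_c(q) = [n]! ℙ(c → [1;n])_q` of a configuration `c` of `n` balls
on `n` sites. -/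
def remixedEulerian (q : ℝ≥0) (c : List ℕ) : ℝ :=
  qFact q c.length *
    (dropProb q ((MSet c).map fun i => (i : ℤ)) (Finset.Icc 1 (c.length : ℤ))).toReal

/-! ### Weakly Łukasiewicz configurations -/

/-- The left-to-right order of a configuration: its balls, in non-decreasing order. -/
def leftToRight (c : List ℕ) : List ℤ := ((MSet c).sort (· ≤ ·)).map fun i => (i : ℤ)

/-- `t` can be reached from `s` by finitely many moves, each bounce going either way. -/
def Reachable (s t : State) : Prop :=
  Relation.ReflTransGen (fun a a' => ∃ b : Bool, a' = move b a) s t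

/-- A configuration of `n` balls is weakly Łukasiewicz if, when its balls are dropped from left to
right, in every possible evolution either the filled set is an interval of `ℤ` at all times, or
some ball falls outside of `[1;n]`.  Equivalently: each state `s` through which an evolution can
pass that ends with all balls stopped within `[1;n]` has an interval as its filled set. -/
def IsWeaklyLukasiewicz (c : List ℕ) : Prop :=
  IsConfiguration c ∧
    ∀ (s : State) (T : Finset ℤ),
      Reachable (∅, leftToRight c) s → Reachable s (T, []) →
      (∀ x ∈ T, x ∈ Set.Icc (1 : ℤ) (c.length : ℤ)) →
      (s.1 : Set ℤ).OrdConnected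

end

end Remixed

open Remixed

/-!
The balls of `γ` are dropped in increasing order.  While the filled set is an interval
`[e + 1; e + r]` and the next ball starts on it or directly next to it, at `e + y`, gambler's ruin
(`finalProb_Icc_cons`) says that the interval grows to the right with probability `[y] / [r + 1]`
and to the left otherwise.  Multiplying by `[n]!` clears the denominators, so the numbers
`A_{(0^i, γ, 0^{n-m-i})}(q)` are computed by a linear recurrence whose state is the number `j` of balls
that went left: a ball at `x` has weight `[x + j]` for going right and `[r + 1] - [x + j]` for going
left.

On the other side, the coefficients of `(t;q)_{r+1} ∑_j t^j ∏_{a ∈ l} [j + a]` satisfy the same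
recurrence when a ball is appended to `l` (`coeff_succ_carlitzSeries_append`).  This is a formal
identity, valid for all positions of the balls; it comes down to the ratio of consecutive
coefficients of `(t;q)_n`.

The two recurrences start from the same value, so the coefficient of `t^i` is the remixed Eulerian
number provided that the formal recurrence never puts weight on an interval whose next ball starts
beyond its right neighbour, for at most `i` moves to the left.  This is where the weak Łukasiewicz
property enters.  The leftmost interval that can be filled by the first `r` balls `x_1 ≤ ⋯ ≤ x_r`
within `[1; n]` ends at `max x_r r`, and every evolution with room left in `[1; n]` can be completed
there, hence `x_{r+1} ≤ max x_r r + 1` (`reachable_leftmost_and_gap`).  Written for `(0^k, γ, 0^j)`,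
these inequalities become weaker when `k` decreases, and they propagate the absence of gaps along
the formal recurrence for all `i ≤ k` (`getElem_add_le_of_coeff_ne_zero`).  The closed formula is
then the expansion of `(t;q)_{n+1}` by the `q`-binomial theorem.
-/

open Remixed

namespace Remixed

/-! ### The coefficients of the `q`-Pochhammer symbol -/

theorem qInt_zero (q : ℝ) : qInt q 0 = 0 := Finset.sum_range_zero _

theorem qInt_succ (q : ℝ) (i : ℕ) : qInt q (i + 1) = qInt q i + q ^ i :=
  Finset.sum_range_succ _ _

theorem qInt_one (q : ℝ) : qInt q 1 = 1 := by rw [qInt_succ, qInt_zero, pow_zero, zero_add]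

theorem qInt_add (q : ℝ) (a b : ℕ) : qInt q (a + b) = qInt q a + q ^ a * qInt q b := by
  induction b with
  | zero => simp [qInt_zero]
  | succ b ih => rw [← add_assoc, qInt_succ, qInt_succ, ih, pow_add]; ring

theorem qInt_succ' (q : ℝ) (i : ℕ) : qInt q (i + 1) = 1 + q * qInt q i := by
  rw [add_comm, qInt_add, qInt_one, pow_one]

theorem qInt_pos {q : ℝ} (hq : 0 < q) {i : ℕ} (hi : 0 < i) : 0 < qInt q i :=
  Finset.sum_pos (fun _ _ => pow_pos hq _) (Finset.nonempty_range_iff.2 hi.ne')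

theorem qFact_zero (q : ℝ) : qFact q 0 = 1 := by simp [qFact]

theorem qFact_succ (q : ℝ) (n : ℕ) : qFact q (n + 1) = qFact q n * qInt q (n + 1) :=
  Finset.prod_Icc_succ_top (by lia) _

theorem qFact_pos {q : ℝ} (hq : 0 < q) (n : ℕ) : 0 < qFact q n :=
  Finset.prod_pos fun _ hi => qInt_pos hq (Finset.mem_Icc.1 hi).1

theorem qBinom_zero_right {q : ℝ} (hq : 0 < q) (n : ℕ) : qBinom q n 0 = 1 := by
  rw [qBinom, if_pos n.zero_le, qFact_zero, one_mul, Nat.sub_zero, div_self (qFact_pos hq n).ne']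

theorem qInt_mul_qBinom_succ {q : ℝ} (hq : 0 < q) (n s : ℕ) :
    qInt q (s + 1) * qBinom q n (s + 1) = qInt q (n - s) * qBinom q n s := by
  rcases lt_or_ge s n with h | h
  · obtain ⟨d, rfl⟩ := Nat.exists_eq_add_of_lt h
    rw [qBinom, qBinom, if_pos (by lia), if_pos (by lia),
      show s + d + 1 - s = d + 1 by lia, show s + d + 1 - (s + 1) = d by lia,
      qFact_succ q s, qFact_succ q d]
    have h1 := (qFact_pos hq s).ne'
    have h2 := (qFact_pos hq d).ne'
    have h3 := (qInt_pos hq s.succ_pos).ne'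
    have h4 := (qInt_pos hq d.succ_pos).ne'
    field_simp
  · rw [qBinom, if_neg (by lia), Nat.sub_eq_zero_of_le h, qInt_zero, mul_zero, zero_mul]

theorem qPochhammer_succ (q : ℝ) (n : ℕ) :
    qPochhammer q (n + 1) = qPochhammer q n * (1 - PowerSeries.X * PowerSeries.C (q ^ n)) :=
  Finset.prod_range_succ _ _

theorem coeff_zero_qPochhammer (q : ℝ) (n : ℕ) : PowerSeries.coeff 0 (qPochhammer q n) = 1 := by
  simp [qPochhammer, map_prod]

theorem coeff_succ_qPochhammer_succ (q : ℝ) (n s : ℕ) :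
    PowerSeries.coeff (s + 1) (qPochhammer q (n + 1)) =
      PowerSeries.coeff (s + 1) (qPochhammer q n) -
        q ^ n * PowerSeries.coeff s (qPochhammer q n) := by
  rw [qPochhammer_succ, mul_sub, mul_one, ← mul_assoc, map_sub, PowerSeries.coeff_mul_C,
    PowerSeries.coeff_succ_mul_X, mul_comm]

/-- Consecutive coefficients of `(t;q)_n` have ratio `([s] - [n]) / [s + 1]`.  This form, with a
difference of `q`-integers, has no truncated subtraction and holds for every real `q`. -/
theorem qInt_mul_coeff_succ_qPochhammer (q : ℝ) (n s : ℕ) :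
    qInt q (s + 1) * PowerSeries.coeff (s + 1) (qPochhammer q n) =
      (qInt q s - qInt q n) * PowerSeries.coeff s (qPochhammer q n) := by
  induction n generalizing s with
  | zero => cases s <;> simp [qPochhammer, qInt_zero, PowerSeries.coeff_one]
  | succ n ih =>
    cases s with
    | zero =>
      have h := ih 0
      rw [coeff_succ_qPochhammer_succ, coeff_zero_qPochhammer, coeff_zero_qPochhammer,
        qInt_succ q n]
      rw [coeff_zero_qPochhammer] at h
      simp only [zero_add, qInt_one, qInt_zero] at h ⊢
      linear_combination h
    | succ s =>
      rw [coeff_succ_qPochhammer_succ, coeff_succ_qPochhammer_succ]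
      set e₀ := PowerSeries.coeff s (qPochhammer q n)
      set e₁ := PowerSeries.coeff (s + 1) (qPochhammer q n)
      linear_combination ih (s + 1) - q ^ (n + 1) * ih s - q ^ n * e₁ * qInt_succ' q (s + 1) +
        e₁ * qInt_succ q n + q ^ n * e₀ * qInt_succ' q s - q ^ n * e₀ * qInt_succ' q n

/-- The `q`-binomial theorem. -/
theorem coeff_qPochhammer {q : ℝ} (hq : 0 < q) (n s : ℕ) :
    PowerSeries.coeff s (qPochhammer q n) = (-1) ^ s * q ^ s.choose 2 * qBinom q n s := by
  induction s with
  | zero => simp [coeff_zero_qPochhammer, qBinom_zero_right hq]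
  | succ s ih =>
    have h0 := (qInt_pos hq s.succ_pos).ne'
    have h1 := qInt_mul_coeff_succ_qPochhammer q n s
    have h2 := qInt_mul_qBinom_succ hq n s
    have h3 : (qInt q s - qInt q n) * qBinom q n s = -(q ^ s * qInt q (n - s)) * qBinom q n s := by
      rcases le_or_gt s n with h | h
      · obtain ⟨d, rfl⟩ := Nat.exists_eq_add_of_le h
        rw [qInt_add, Nat.add_sub_cancel_left]; ring
      · rw [qBinom, if_neg (by lia), mul_zero, mul_zero]
    have h4 : q ^ (s + 1).choose 2 = q ^ s * q ^ s.choose 2 := by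
      rw [← pow_add, Nat.choose_succ_succ' s 1, Nat.choose_one_right]
    refine mul_left_cancel₀ h0 ?_
    rw [h1, ih, h4, pow_succ]
    linear_combination (-1) ^ s * q ^ s.choose 2 * h3 + (-1) ^ s * q ^ s * q ^ s.choose 2 * h2

/-! ### The Carlitz series of a list of balls -/

/-- The power series `(t;q)_{r+1} ∑_j t^j ∏_{a ∈ l} [j + a]`, where `r` is the length of `l`. -/
noncomputable def carlitzSeries (q : ℝ) (l : List ℕ) : PowerSeries ℝ :=
  qPochhammer q (l.length + 1) * PowerSeries.mk fun j => (l.map fun a => qInt q (j + a)).prod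

theorem carlitzSeries_nil (q : ℝ) : carlitzSeries q [] = 1 := by
  simp [carlitzSeries, qPochhammer, sub_mul, PowerSeries.ext_iff]
  intro n
  cases n <;> simp [PowerSeries.coeff_succ_X_mul]

theorem coeff_zero_carlitzSeries_append (q : ℝ) (l : List ℕ) (x : ℕ) :
    PowerSeries.coeff 0 (carlitzSeries q (l ++ [x])) =
      qInt q x * PowerSeries.coeff 0 (carlitzSeries q l) := by
  simp only [carlitzSeries, PowerSeries.coeff_mul, Finset.Nat.antidiagonal_zero,
    Finset.sum_singleton, coeff_zero_qPochhammer, PowerSeries.coeff_mk, List.map_append,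
    List.prod_append, List.map_singleton, List.prod_singleton, zero_add]
  ring

/-- Appending one ball acts on the coefficients like one step of the drop process: the weights
`[x + i]` and `[r + 1] - [x + i]`, divided by `[r + 1]`, are the probabilities that a ball dropped
at `x` onto the interval `[1 - i; r - i]` leaves it on the right, respectively on the left. -/
theorem coeff_succ_carlitzSeries_append (q : ℝ) (l : List ℕ) (x i : ℕ) :
    PowerSeries.coeff (i + 1) (carlitzSeries q (l ++ [x])) =
      qInt q (x + (i + 1)) * PowerSeries.coeff (i + 1) (carlitzSeries q l) +
        (qInt q (l.length + 1) - qInt q (x + i)) * PowerSeries.coeff i (carlitzSeries q l) := by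
  simp only [carlitzSeries, PowerSeries.coeff_mul, Finset.Nat.sum_antidiagonal_succ,
    coeff_zero_qPochhammer, PowerSeries.coeff_mk, List.map_append, List.prod_append,
    List.map_singleton, List.prod_singleton, List.length_append, List.length_singleton]
  rw [mul_add, Finset.mul_sum, Finset.mul_sum, add_assoc (qInt q (x + (i + 1)) * _),
    ← Finset.sum_add_distrib]
  congr 1
  · rw [add_comm x]; ring
  · refine Finset.sum_congr rfl fun p hp => ?_
    rw [Finset.HasAntidiagonal.mem_antidiagonal] at hp
    obtain ⟨s, j⟩ := p
    dsimp only at hp ⊢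
    subst hp
    have h := qInt_mul_coeff_succ_qPochhammer q (l.length + 1) s
    rw [coeff_succ_qPochhammer_succ q (l.length + 1) s,
      show x + (s + j + 1) = (j + x) + (s + 1) by lia, show x + (s + j) = (j + x) + s by lia,
      qInt_add q (j + x) (s + 1), qInt_add q (j + x) s]
    -- `[l.length + 1 + (j + x)]` expanded in both ways
    have h' := (qInt_add q (j + x) (l.length + 1)).symm.trans
      ((congrArg (qInt q) (add_comm _ _)).trans (qInt_add q (l.length + 1) (j + x)))
    set F := (l.map fun a => qInt q (j + a)).prod
    set e₀ := PowerSeries.coeff s (qPochhammer q (l.length + 1))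
    linear_combination F * e₀ * h' - F * q ^ (j + x) * h

/-! ### The balls of a padded configuration -/

theorem MSet_nil : MSet [] = 0 := by simp [MSet]

theorem MSet_cons (a : ℕ) (c : List ℕ) :
    MSet (a :: c) = Multiset.replicate a 1 + (MSet c).map (· + 1) := by
  rw [MSet, MSet, ← Multiset.coe_mapAddMonoidHom, map_sum]
  simp only [List.length_cons, Fin.sum_univ_succ, Multiset.coe_mapAddMonoidHom,
    Multiset.map_replicate]
  rfl

theorem MSet_append_replicate_zero (c : List ℕ) (j : ℕ) :
    MSet (c ++ List.replicate j 0) = MSet c := by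
  induction c with
  | nil =>
    induction j with
    | zero => rfl
    | succ j ih =>
      rw [List.nil_append, MSet_nil] at ih
      rw [List.nil_append, List.replicate_succ, MSet_cons, ih, MSet_nil]
      rfl
  | cons a c ih => rw [List.cons_append, MSet_cons, MSet_cons, ih]

theorem MSet_pad (i : ℕ) (γ : List ℕ) (j : ℕ) : MSet (pad i γ j) = (MSet γ).map (· + i) := by
  rw [pad, MSet_append_replicate_zero]
  induction i with
  | zero => simp
  | succ i ih =>
    rw [List.replicate_succ, List.cons_append, MSet_cons, ih, Multiset.replicate_zero, zero_add,
      Multiset.map_map]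
    rfl

theorem card_MSet (c : List ℕ) : (MSet c).card = c.sum := by
  induction c with
  | nil => rw [MSet_nil]; rfl
  | cons a c ih => simp [MSet_cons, ih]

theorem mem_MSet_bounds {c : List ℕ} {a : ℕ} (h : a ∈ MSet c) : 1 ≤ a ∧ a ≤ c.length := by
  induction c generalizing a with
  | nil => simp [MSet_nil] at h
  | cons b c ih =>
    rw [MSet_cons, Multiset.mem_add, Multiset.mem_map] at h
    rw [List.length_cons]
    rcases h with h | ⟨a, h, rfl⟩
    · have := Multiset.eq_of_mem_replicate h
      lia
    · have := ih h
      lia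

theorem one_mem_MSet {γ : List ℕ} (h : IsCore γ) : 1 ∈ MSet γ := by
  obtain ⟨h0, h1, -⟩ := h
  cases γ with
  | nil => exact absurd rfl h0
  | cons a c =>
    rw [List.head_cons] at h1
    rw [MSet_cons, Multiset.mem_add]
    exact Or.inl (Multiset.mem_replicate.2 ⟨h1.ne', rfl⟩)

theorem length_pad (i : ℕ) (γ : List ℕ) (j : ℕ) : (pad i γ j).length = i + γ.length + j := by
  simp [pad, add_assoc]

theorem leftToRight_pad (i : ℕ) (γ : List ℕ) (j : ℕ) :
    leftToRight (pad i γ j) =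
      ((MSet γ).sort (· ≤ ·)).map fun a => ((a + i : ℕ) : ℤ) := by
  rw [leftToRight, MSet_pad, ← Multiset.map_sort (r := (· ≤ ·)) (f := (· + i))]
  · simp only [bind_pure_comp, List.map_eq_map, List.map_map]
    rfl
  · intro a _ b _
    exact (Nat.add_le_add_iff_right).symm

theorem remixedEulerian_pad (q : ℝ≥0) (i : ℕ) (γ : List ℕ) (j n : ℕ)
    (hn : i + γ.length + j = n) :
    remixedEulerian q (pad i γ j) = qFact q n *
      (finalProb q (Finset.Icc 1 (n : ℤ))
        (∅, ((MSet γ).sort (· ≤ ·)).map fun a => ((a + i : ℕ) : ℤ))).toReal := by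
  rw [remixedEulerian, length_pad, hn, MSet_pad]
  nth_rw 1 [← Multiset.sort_eq (MSet γ) (· ≤ ·)]
  simp only [Multiset.map_coe, bind_pure_comp, Multiset.fmap_def, List.map_map]
  rfl

/-! ### Dropping a ball onto an interval -/

theorem finalProb_eq_zero_of_not_subset (q : ℝ≥0) {T S : Finset ℤ} (u : List ℤ) (h : ¬ S ⊆ T) :
    finalProb q T (S, u) = 0 := by
  have key : ∀ (N : ℕ) (s : State), ¬ s.1 ⊆ T → law q N s (T, []) = 0 := by
    intro N
    induction N with
    | zero =>
      intro s hs
      rw [law, PMF.pure_apply, if_neg]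
      rintro rfl
      exact hs subset_rfl
    | succ N ih =>
      intro s hs
      have hmove : ∀ b, s.1 ⊆ (move b s).1 := by
        intro b
        obtain ⟨S, u⟩ := s
        cases u with
        | nil => exact subset_rfl
        | cons x u =>
          rw [move]
          split_ifs
          · exact subset_rfl
          · exact Finset.subset_insert _ _
      rw [law_succ_apply, ih _ fun hc => hs ((hmove _).trans hc),
        ih _ fun hc => hs ((hmove _).trans hc), mul_zero, mul_zero, add_zero]
  exact le_antisymm (iSup_le fun N => (key N _ h).le) zero_le

/-- Gambler's ruin: a ball dropped at the site `e + y` onto the filled interval `[e + 1; e + r]`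
ends at `e + r + 1` with probability `[y] / [r + 1]` and at `e` otherwise.  The ball may also start
on one of these two sites. -/
theorem finalProb_Icc_cons {q : ℝ≥0} (hq : 0 < q) (T : Finset ℤ) (e : ℤ) (r y : ℕ)
    (hy : y ≤ r + 1) (u : List ℤ) :
    (finalProb q T (Finset.Icc (e + 1) (e + r), (e + y) :: u)).toReal =
      qInt q y / qInt q (r + 1) * (finalProb q T (Finset.Icc (e + 1) (e + r + 1), u)).toReal +
        (1 - qInt q y / qInt q (r + 1)) *
          (finalProb q T (Finset.Icc e (e + r), u)).toReal := by
  set R := (finalProb q T (Finset.Icc (e + 1) (e + r + 1), u)).toReal with hR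
  set L := (finalProb q T (Finset.Icc e (e + r), u)).toReal with hL
  have hr : qInt q (r + 1) ≠ 0 := (qInt_pos (NNReal.coe_pos.2 hq) r.succ_pos).ne'
  -- the maximum principle compares functions on all of `ℤ`, so the candidate is continued by
  -- the true probability away from the interval and its two neighbours
  let f : ℤ → ℝ := fun x => (finalProb q T (Finset.Icc (e + 1) (e + r), x :: u)).toReal
  let h : ℤ → ℝ := fun x => qInt q (x - e).toNat / qInt q (r + 1)
  let g : ℤ → ℝ := fun x => if e ≤ x ∧ x ≤ e + r + 1 then h x * R + (1 - h x) * L else f x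
  have hfg : f (e + y) = g (e + y) := by
    refine harmonic_unique q (Finset.Icc (e + 1) (e + r)) f g (fun x hx => ?_)
      (fun x hx => finalProb_bounce q T _ u hx) (fun x hx => ?_) (e + y)
    · by_cases hc : e ≤ x ∧ x ≤ e + r + 1
      · simp only [g, if_pos hc, f, h]
        rw [finalProb_hole q T _ u hx]
        rw [Finset.mem_Icc] at hx
        have hcases : x = e ∨ x = e + r + 1 := by lia
        rcases hcases with rfl | rfl
        · have hins : insert x (Finset.Icc (x + 1) (x + r)) = Finset.Icc x (x + r) := by
            ext z
            simp only [Finset.mem_insert, Finset.mem_Icc]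
            lia
          simp [hins, qInt_zero, hL]
        · have hins : insert (e + r + 1) (Finset.Icc (e + 1) (e + r)) =
              Finset.Icc (e + 1) (e + r + 1) := by
            ext z
            simp only [Finset.mem_insert, Finset.mem_Icc]
            lia
          rw [hins, show (e + r + 1 - e).toNat = r + 1 by lia, div_self hr]
          simp [hR]
      · simp only [g, if_neg hc]
    · rw [Finset.mem_Icc] at hx
      obtain ⟨z, rfl⟩ : ∃ z : ℕ, x = e + z + 1 := ⟨(x - e - 1).toNat, by lia⟩
      simp only [g, h]
      rw [if_pos (by lia), if_pos (by lia), if_pos (by lia),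
        show (e + z + 1 - e).toNat = z + 1 by lia, show (e + z + 1 - 1 - e).toNat = z by lia,
        show (e + z + 1 + 1 - e).toNat = z + 1 + 1 by lia, qInt_succ _ (z + 1), qInt_succ _ z]
      have h1 : (1 + q : ℝ) ≠ 0 := by positivity
      field_simp
      ring
  have hc : e ≤ e + (y : ℤ) ∧ e + (y : ℤ) ≤ e + r + 1 := by lia
  simpa only [f, g, h, if_pos hc, add_sub_cancel_left, Int.toNat_natCast] using hfg

/-- Duality between the forward recurrence for the weights, `c ↦ d`, and the one-step equation for
the values `w`: the two pairings agree up to the boundary term of a move out of the range. -/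
theorem sum_mul_eq_sum_mul_of_step (c d w A B : ℕ → ℝ) (h0 : d 0 = A 0 * c 0)
    (h : ∀ j, d (j + 1) = A (j + 1) * c (j + 1) + B j * c j) (N : ℕ) :
    ∑ j ∈ Finset.range (N + 1), d j * w j + c N * B N * w (N + 1) =
      ∑ j ∈ Finset.range (N + 1), c j * (A j * w j + B j * w (j + 1)) := by
  induction N with
  | zero => simp [h0]; ring
  | succ N ih =>
    rw [Finset.sum_range_succ, Finset.sum_range_succ _ (N + 1), ← ih, h]
    ring

/-- If every state that carries weight has its next ball on or directly right of the filled
interval, the probability of filling exactly `[1; n]` is a coefficient of the Carlitz series.  The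
index `j` of a coefficient counts the balls that went left, so that `[i - j + 1; i - j + r]` is
the filled interval after `r` balls. -/
theorem qFact_mul_finalProb_eq_coeff {q : ℝ≥0} (hq : 0 < q) (l : List ℕ) (hl : l ≠ []) (i : ℕ)
    (hpos : ∀ a ∈ l, 1 ≤ a)
    (hstack : ∀ (r : ℕ) (hr : r < l.length), ∀ j ≤ i,
      PowerSeries.coeff j (carlitzSeries q (l.take r)) ≠ 0 → l[r] + j ≤ r + 1) :
    qFact q l.length * (finalProb q (Finset.Icc 1 (l.length : ℤ))
        (∅, l.map fun a => ((a + i : ℕ) : ℤ))).toReal =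
      PowerSeries.coeff i (carlitzSeries q l) := by
  set T := Finset.Icc 1 (l.length : ℤ) with hT
  let fp : ℕ → ℕ → ℝ := fun r j => (finalProb q T
    (Finset.Icc ((i : ℤ) - j + 1) ((i : ℤ) - j + r),
      (l.drop r).map fun a => ((a + i : ℕ) : ℤ))).toReal
  let Φ : ℕ → ℝ := fun r => ∑ j ∈ Finset.range (i + 1),
    PowerSeries.coeff j (carlitzSeries q (l.take r)) / qFact q r * fp r j
  have hq' : (0 : ℝ) < q := NNReal.coe_pos.2 hq
  have hstep : ∀ r < l.length, Φ (r + 1) = Φ r := by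
    intro r hr
    have hx : 1 ≤ l[r] := hpos _ (List.getElem_mem hr)
    have hF := (qFact_pos hq' r).ne'
    have hR := (qInt_pos hq' r.succ_pos).ne'
    set x := l[r] with hxdef
    have htake : l.take (r + 1) = l.take r ++ [x] := by
      rw [List.take_succ_eq_append_getElem hr]
    have hlen : (l.take r).length = r := by rw [List.length_take]; lia
    -- the ball that would be the `(i + 1)`-st to go left fills a site outside of `[1; n]`
    have hlast : fp (r + 1) (i + 1) = 0 := by
      simp only [fp]
      rw [finalProb_eq_zero_of_not_subset, ENNReal.toReal_zero]
      intro hsub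
      have := hsub (Finset.mem_Icc.2 ⟨le_rfl, by push_cast; lia⟩)
      rw [hT, Finset.mem_Icc] at this
      push_cast at this
      lia
    have hsum := sum_mul_eq_sum_mul_of_step
      (fun j => PowerSeries.coeff j (carlitzSeries q (l.take r)))
      (fun j => PowerSeries.coeff j (carlitzSeries q (l.take (r + 1))))
      (fp (r + 1)) (fun j => qInt q (x + j)) (fun j => qInt q (r + 1) - qInt q (x + j))
      (by rw [htake, coeff_zero_carlitzSeries_append, add_zero])
      (fun j => by rw [htake, coeff_succ_carlitzSeries_append, hlen]) i
    rw [hlast, mul_zero, add_zero] at hsum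
    have hdiv : Φ (r + 1) = (∑ j ∈ Finset.range (i + 1),
        PowerSeries.coeff j (carlitzSeries q (l.take (r + 1))) * fp (r + 1) j) /
          qFact q (r + 1) := by
      simp only [Φ, Finset.sum_div]
      exact Finset.sum_congr rfl fun j _ => by ring
    rw [hdiv, hsum, Finset.sum_div]
    refine Finset.sum_congr rfl fun j hj => ?_
    by_cases hc : PowerSeries.coeff j (carlitzSeries q (l.take r)) = 0
    · rw [hc]; simp
    · have hxr := hstack r hr j (Nat.lt_succ_iff.1 (Finset.mem_range.1 hj)) hc
      have hruin := finalProb_Icc_cons hq T ((i : ℤ) - j) r (x + j) hxr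
        ((l.drop (r + 1)).map fun a => ((a + i : ℕ) : ℤ))
      have hdrop : (l.drop r).map (fun a => ((a + i : ℕ) : ℤ)) =
          ((i : ℤ) - j + (x + j : ℕ)) :: (l.drop (r + 1)).map fun a => ((a + i : ℕ) : ℤ) := by
        rw [List.drop_eq_getElem_cons hr, List.map_cons]
        congr 1
        push_cast
        ring
      have hfp : fp r j = qInt q (x + j) / qInt q (r + 1) * fp (r + 1) j +
          (1 - qInt q (x + j) / qInt q (r + 1)) * fp (r + 1) (j + 1) := by
        simp only [fp]
        rw [hdrop, hruin]
        congr 6 <;> push_cast <;> ring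
      rw [hfp, qFact_succ]
      field_simp
  have hconst : ∀ r ≤ l.length, Φ r = Φ 0 := by
    intro r
    induction r with
    | zero => exact fun _ => rfl
    | succ r ih => exact fun hr => (hstep r hr).trans (ih (by lia))
  have hzero : Φ 0 = (finalProb q T (∅, l.map fun a => ((a + i : ℕ) : ℤ))).toReal := by
    have hempty : Finset.Icc ((i : ℤ) - (0 : ℕ) + 1) ((i : ℤ) - (0 : ℕ) + (0 : ℕ)) = ∅ :=
      Finset.Icc_eq_empty (by lia)
    simp only [Φ, List.take_zero, carlitzSeries_nil]
    rw [Finset.sum_eq_single 0]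
    · simp only [fp]
      rw [hempty]
      simp [qFact_zero]
    · intro j _ hj
      rw [PowerSeries.coeff_one, if_neg hj]
      simp
    · simp
  have hend : Φ l.length = PowerSeries.coeff i (carlitzSeries q l) / qFact q l.length := by
    have hlpos := List.length_pos_iff.2 hl
    simp only [Φ, List.take_length]
    rw [Finset.sum_eq_single i]
    · simp only [fp, List.drop_length, List.map_nil]
      rw [finalProb_nil, if_pos] <;> simp [hT]
    · intro j hj hji
      have hne : ¬ T = Finset.Icc ((i : ℤ) - j + 1) ((i : ℤ) - j + l.length) := by
        intro h
        have h1 : (1 : ℤ) ∈ T := Finset.mem_Icc.2 ⟨le_rfl, by lia⟩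
        rw [h, Finset.mem_Icc] at h1
        rw [Finset.mem_range] at hj
        lia
      simp only [fp, List.drop_length, List.map_nil]
      rw [finalProb_nil, if_neg hne]
      simp
    · simp
  rw [← hzero, ← hconst _ le_rfl, hend]
  field_simp [(qFact_pos hq' l.length).ne']

/-! ### Evolutions of the drop process -/

theorem reachable_hole {S : Finset ℤ} {x : ℤ} (u : List ℤ) (hx : x ∉ S) :
    Reachable (S, x :: u) (insert x S, u) :=
  Relation.ReflTransGen.single ⟨true, by rw [move, if_neg hx]⟩

/-- A ball can be steered to the first hole on its way to a given hole `h`. -/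
theorem exists_reachable_of_hole {S : Finset ℤ} {h : ℤ} (hh : h ∉ S) (x : ℤ) (u : List ℤ) :
    ∃ y ∈ Set.uIcc x h, y ∉ S ∧ Reachable (S, x :: u) (insert y S, u) := by
  induction hd : (h - x).natAbs generalizing x with
  | zero =>
    obtain rfl : h = x := by lia
    exact ⟨h, Set.left_mem_uIcc, hh, reachable_hole u hh⟩
  | succ d ih =>
    by_cases hx : x ∈ S
    · rcases lt_or_ge h x with hlt | hge
      · obtain ⟨y, hy, hyS, hr⟩ := ih (x - 1) (by lia)
        refine ⟨y, ?_, hyS, hr.head ⟨true, by rw [move, if_pos hx, cond_true]⟩⟩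
        rw [Set.mem_uIcc] at hy ⊢
        lia
      · obtain ⟨y, hy, hyS, hr⟩ := ih (x + 1) (by lia)
        refine ⟨y, ?_, hyS, hr.head ⟨false, by rw [move, if_pos hx, cond_false]⟩⟩
        rw [Set.mem_uIcc] at hy ⊢
        have : x ≠ h := fun hxh => hh (hxh ▸ hx)
        lia
    · exact ⟨x, Set.left_mem_uIcc, hx, reachable_hole u hx⟩

theorem reachable_Icc_right {a b x : ℤ} (ha : a ≤ x) (hb : x ≤ b + 1) (u : List ℤ) :
    Reachable (Finset.Icc a b, x :: u) (Finset.Icc a (b + 1), u) := by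
  obtain ⟨y, hy, hyS, hr⟩ := exists_reachable_of_hole (S := Finset.Icc a b) (h := b + 1)
    (by simp) x u
  rw [Set.uIcc_of_le hb, Set.mem_Icc] at hy
  rw [Finset.mem_Icc] at hyS
  have hins : insert y (Finset.Icc a b) = Finset.Icc a (b + 1) := by
    ext z
    simp only [Finset.mem_insert, Finset.mem_Icc]
    lia
  rwa [hins] at hr

theorem reachable_Icc_left {a b x : ℤ} (ha : a - 1 ≤ x) (hb : x ≤ b) (u : List ℤ) :
    Reachable (Finset.Icc a b, x :: u) (Finset.Icc (a - 1) b, u) := by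
  obtain ⟨y, hy, hyS, hr⟩ := exists_reachable_of_hole (S := Finset.Icc a b) (h := a - 1)
    (by simp) x u
  rw [Set.uIcc_of_ge ha, Set.mem_Icc] at hy
  rw [Finset.mem_Icc] at hyS
  have hins : insert y (Finset.Icc a b) = Finset.Icc (a - 1) b := by
    ext z
    simp only [Finset.mem_insert, Finset.mem_Icc]
    lia
  rwa [hins] at hr

/-- As long as there is room in `[1; n]`, the remaining balls can all be stopped there. -/
theorem exists_reachable_subset_Icc {n : ℕ} (u : List ℤ) (S : Finset ℤ)
    (hS : S ⊆ Finset.Icc 1 (n : ℤ)) (hu : ∀ x ∈ u, x ∈ Finset.Icc 1 (n : ℤ))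
    (hcard : S.card + u.length ≤ n) :
    ∃ T ⊆ Finset.Icc 1 (n : ℤ), Reachable (S, u) (T, []) := by
  induction u generalizing S with
  | nil => exact ⟨S, hS, Relation.ReflTransGen.refl⟩
  | cons x u ih =>
    rw [List.length_cons] at hcard
    obtain ⟨h, hhT, hh⟩ : ∃ h ∈ Finset.Icc 1 (n : ℤ), h ∉ S :=
      Finset.exists_mem_notMem_of_card_lt_card (by rw [Int.card_Icc]; lia)
    obtain ⟨y, hy, hyS, hr⟩ := exists_reachable_of_hole hh x u
    have hxT := hu x List.mem_cons_self
    obtain ⟨T, hT, hr'⟩ := ih (insert y S)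
      (by
        refine Finset.insert_subset ?_ hS
        rw [Set.mem_uIcc] at hy
        rw [Finset.mem_Icc] at hxT hhT ⊢
        lia)
      (fun z hz => hu z (List.mem_cons_of_mem _ hz))
      (by rw [Finset.card_insert_of_notMem hyS]; lia)
    exact ⟨T, hT, hr.trans hr'⟩

/-! ### Gaps between consecutive balls of a weakly Łukasiewicz configuration -/

/-- Suppose that the balls of the sorted list `l` are dropped in this order and that every evolution
within `[1; n]` keeps the filled set an interval.  After ball number `r + 1` the leftmost interval
that can be filled ends at `max l[r] (r + 1)`, so the next ball starts at most one site further
right: otherwise it leaves a gap, and the evolution can be completed within `[1; n]`. -/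
theorem reachable_leftmost_and_gap {l : List ℤ} (hsort : l.Pairwise (· ≤ ·))
    (hmem : ∀ x ∈ l, x ∈ Finset.Icc 1 (l.length : ℤ))
    (hint : ∀ (s : State) (T : Finset ℤ), Reachable (∅, l) s → Reachable s (T, []) →
      T ⊆ Finset.Icc 1 (l.length : ℤ) → (s.1 : Set ℤ).OrdConnected)
    (r : ℕ) (hr : r < l.length) :
    Reachable (∅, l) (Finset.Icc (max l[r] (r + 1) - r) (max l[r] (r + 1)), l.drop (r + 1)) ∧
      ∀ h : r + 1 < l.length, l[r + 1] ≤ max l[r] (r + 1) + 1 := by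
  have hbound : ∀ (r : ℕ) (hr : r < l.length), 1 ≤ l[r] ∧ l[r] ≤ l.length := fun r hr =>
    Finset.mem_Icc.1 (hmem _ (List.getElem_mem hr))
  have hgap : ∀ (r : ℕ) (hr : r < l.length),
      Reachable (∅, l) (Finset.Icc (max l[r] (r + 1) - r) (max l[r] (r + 1)), l.drop (r + 1)) →
      ∀ h : r + 1 < l.length, l[r + 1] ≤ max l[r] (r + 1) + 1 := by
    intro r hr hreach h
    by_contra! hlt
    have h0 := hbound r hr
    have h1 := hbound (r + 1) h
    set b := max l[r] ((r : ℤ) + 1) with hb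
    set x := l[r + 1] with hx
    have hnot : x ∉ Finset.Icc (b - r) b := by
      rw [Finset.mem_Icc]
      lia
    rw [List.drop_eq_getElem_cons h] at hreach
    have hreach' := hreach.trans (reachable_hole (l.drop (r + 1 + 1)) hnot)
    obtain ⟨T, hT, hfin⟩ := exists_reachable_subset_Icc (n := l.length) (l.drop (r + 1 + 1))
      (insert x (Finset.Icc (b - r) b))
      (by
        intro z hz
        rw [Finset.mem_insert, Finset.mem_Icc] at hz
        rw [Finset.mem_Icc]
        lia)
      (fun z hz => hmem z (List.mem_of_mem_drop hz))
      (by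
        rw [Finset.card_insert_of_notMem hnot, Int.card_Icc, List.length_drop]
        lia)
    have hconn := hint _ T hreach' hfin hT
    have hmid : b + 1 ∈ ((insert x (Finset.Icc (b - r) b) : Finset ℤ) : Set ℤ) :=
      hconn.out (x := b) (y := x) (by simp) (Finset.mem_coe.2 (Finset.mem_insert_self _ _))
        ⟨by lia, by lia⟩
    rw [Finset.mem_coe, Finset.mem_insert, Finset.mem_Icc] at hmid
    lia
  suffices hreach : Reachable (∅, l)
      (Finset.Icc (max l[r] (r + 1) - r) (max l[r] (r + 1)), l.drop (r + 1)) from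
    ⟨hreach, hgap r hr hreach⟩
  induction r with
  | zero =>
    have h0 := hbound 0 hr
    have hstep := reachable_hole (S := ∅) (x := l[0]) (l.drop 1) (Finset.notMem_empty _)
    rw [← List.drop_eq_getElem_cons hr, List.drop_zero] at hstep
    have hset : Finset.Icc (max l[0] ((0 : ℕ) + 1 : ℤ) - (0 : ℕ)) (max l[0] ((0 : ℕ) + 1 : ℤ)) =
        insert l[0] ∅ := by
      have hmax : max l[0] ((0 : ℕ) + 1 : ℤ) = l[0] := by lia
      rw [hmax]
      simp
    rw [hset]
    exact hstep
  | succ r ih =>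
    have hr' : r < l.length := by lia
    have hprev := ih hr'
    have hg := hgap r hr' hprev hr
    have h0 := hbound r hr'
    have hle : l[r] ≤ l[r + 1] := List.pairwise_iff_getElem.1 hsort r (r + 1) hr' hr (by lia)
    rw [List.drop_eq_getElem_cons hr] at hprev
    set x := l[r]
    set y := l[r + 1]
    -- the ball goes left if it lands on the interval and the site `0` is not reached by this
    by_cases hcase : y ≤ max x ((r : ℤ) + 1) ∧ (r : ℤ) + 1 < x
    · have hstep := hprev.trans (reachable_Icc_left (by lia) hcase.1 _)
      have hmax : max y (((r + 1 : ℕ) : ℤ) + 1) = max x ((r : ℤ) + 1) := by lia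
      rwa [hmax, show max x ((r : ℤ) + 1) - ((r + 1 : ℕ) : ℤ) = max x ((r : ℤ) + 1) - r - 1 by lia]
    · have hstep := hprev.trans (reachable_Icc_right (by lia) hg _)
      have hmax : max y (((r + 1 : ℕ) : ℤ) + 1) = max x ((r : ℤ) + 1) + 1 := by lia
      rwa [hmax, show max x ((r : ℤ) + 1) + 1 - ((r + 1 : ℕ) : ℤ) = max x ((r : ℤ) + 1) - r by lia]

/-- The combinatorial content of the weak Łukasiewicz property of `(0^k, γ, 0^j)`, for the balls
of `γ` in increasing order. -/
theorem IsWeaklyLukasiewicz.getElem_succ_le {k j : ℕ} {γ : List ℕ}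
    (h : IsWeaklyLukasiewicz (pad k γ j)) (hlen : k + γ.length + j = γ.sum)
    (r : ℕ) (hr : r + 1 < ((MSet γ).sort (· ≤ ·)).length) :
    ((MSet γ).sort (· ≤ ·))[r + 1] + k ≤
      max (((MSet γ).sort (· ≤ ·))[r] + k) (r + 1) + 1 := by
  obtain ⟨-, hint⟩ := h
  rw [leftToRight_pad, length_pad, hlen] at hint
  have hL : ((MSet γ).sort (· ≤ ·)).length = γ.sum := by
    rw [Multiset.length_sort, card_MSet]
  have hb : ∀ a ∈ (MSet γ).sort (· ≤ ·), 1 ≤ a ∧ a ≤ γ.length := fun a ha =>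
    mem_MSet_bounds ((Multiset.mem_sort (· ≤ ·)).1 ha)
  have hs := Multiset.pairwise_sort (MSet γ) (· ≤ ·)
  set L := (MSet γ).sort (· ≤ ·)
  have hgap := (reachable_leftmost_and_gap (l := L.map fun a => ((a + k : ℕ) : ℤ))
    (by
      rw [List.pairwise_map]
      exact hs.imp fun hab => by lia)
    (by
      intro x hx
      obtain ⟨a, ha, rfl⟩ := List.mem_map.1 hx
      have := hb a ha
      rw [List.length_map, Finset.mem_Icc]
      lia)
    (by
      intro s T h1 h2 h3
      refine hint s T h1 h2 fun x hx => ?_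
      have := h3 hx
      rwa [List.length_map, hL, Finset.mem_Icc] at this)
    r (by rw [List.length_map]; lia)).2 (by rwa [List.length_map])
  simp only [List.getElem_map] at hgap
  lia

/-- Balls without large gaps stay stacked: a coefficient of the Carlitz series of the first `r`
balls can only be nonzero if the next ball starts on or directly right of the interval that belongs
to it.  At the start this is the assumption on the first ball; later on, the weight
`[r + 1] - [x + j]` of a move to the left vanishes for a ball starting directly right of the
interval. -/
theorem getElem_add_le_of_coeff_ne_zero {q : ℝ} {l : List ℕ} {k : ℕ}
    (hfirst : ∀ h : 0 < l.length, l[0] ≤ 1)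
    (hgap : ∀ (r : ℕ) (h : r + 1 < l.length), l[r + 1] + k ≤ max (l[r] + k) (r + 1) + 1)
    (r : ℕ) (hr : r < l.length) (j : ℕ) (hj : j ≤ k)
    (hc : PowerSeries.coeff j (carlitzSeries q (l.take r)) ≠ 0) : l[r] + j ≤ r + 1 := by
  induction r generalizing j with
  | zero =>
    rw [List.take_zero, carlitzSeries_nil, PowerSeries.coeff_one] at hc
    have : j = 0 := by
      by_contra h
      exact hc (if_neg h)
    have := hfirst hr
    lia
  | succ r ih =>
    have hr' : r < l.length := by lia
    have hlen : (l.take r).length = r := by rw [List.length_take]; lia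
    have hx : l[r] + j ≤ r + 1 := by
      rw [List.take_succ_eq_append_getElem hr'] at hc
      cases j with
      | zero =>
        rw [coeff_zero_carlitzSeries_append] at hc
        exact ih hr' 0 hj (right_ne_zero_of_mul hc)
      | succ j =>
        rw [coeff_succ_carlitzSeries_append, hlen] at hc
        by_cases h0 : PowerSeries.coeff (j + 1) (carlitzSeries q (l.take r)) = 0
        · rw [h0, mul_zero, zero_add] at hc
          have h1 := ih hr' j (by lia) (right_ne_zero_of_mul hc)
          have h2 : l[r] + j ≠ r + 1 := fun h => left_ne_zero_of_mul hc (by rw [h, sub_self])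
          lia
        · exact ih hr' (j + 1) hj h0
    have := hgap r hr
    lia

end Remixed

theorem mainTheorem1 (q : ℝ≥0) (hq : 0 < q) (γ : List ℕ) (hγ : IsCore γ)
    (m n k : ℕ) (hm : m = γ.length) (hn : n = γ.sum)
    (hk : IsGreatest
      {k : ℕ | m + k ≤ n ∧ IsWeaklyLukasiewicz (pad k γ (n - m - k))} k) :
    EqMod (k + 1)
      (∑ i ∈ Finset.range (n - m + 1),
        PowerSeries.X ^ i * PowerSeries.C (remixedEulerian q (pad i γ (n - m - i))))
      (qPochhammer q (n + 1) *
        PowerSeries.mk fun j => ((MSet γ).map fun a => qInt q (j + a)).prod) ∧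
    remixedEulerian q (pad k γ (n - m - k)) =
      ∑ j ∈ Finset.range (k + 1),
        (-1) ^ (j + k) * (q : ℝ) ^ (k - j).choose 2 * qBinom q (n + 1) (k - j) *
          ((MSet γ).map fun a => qInt q (j + a)).prod := by
  obtain ⟨⟨hkn, hW⟩, -⟩ := hk
  set l := (MSet γ).sort (· ≤ ·) with hl
  have hL : l.length = n := by rw [hl, Multiset.length_sort, card_MSet, hn]
  have hmem : ∀ a, a ∈ l ↔ a ∈ MSet γ := fun a => Multiset.mem_sort (· ≤ ·)
  have hone : 1 ∈ l := (hmem 1).2 (one_mem_MSet hγ)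
  have hfirst : ∀ h : 0 < l.length, l[0] ≤ 1 := by
    intro h
    obtain ⟨p, hp, hp1⟩ := List.getElem_of_mem hone
    rcases Nat.eq_zero_or_pos p with rfl | hp0
    · exact hp1.le
    · exact hp1 ▸ List.pairwise_iff_getElem.1 (Multiset.pairwise_sort (MSet γ) (· ≤ ·))
        0 p h hp hp0
  have hgap := hW.getElem_succ_le (by lia)
  have hseries : carlitzSeries q l = qPochhammer q (n + 1) *
      PowerSeries.mk fun j => ((MSet γ).map fun a => qInt q (j + a)).prod := by
    rw [carlitzSeries, hL]
    congr 2
    funext j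
    rw [← Multiset.prod_coe, ← Multiset.map_coe, hl, Multiset.sort_eq]
  have hA : ∀ i ≤ k, remixedEulerian q (pad i γ (n - m - i)) =
      PowerSeries.coeff i (qPochhammer q (n + 1) *
        PowerSeries.mk fun j => ((MSet γ).map fun a => qInt q (j + a)).prod) := by
    intro i hi
    rw [remixedEulerian_pad q i γ (n - m - i) n (by lia), ← hseries,
      ← qFact_mul_finalProb_eq_coeff hq l (List.ne_nil_of_mem hone) i
        (fun a ha => (mem_MSet_bounds ((hmem a).1 ha)).1)
        (fun r hr j hj hc => getElem_add_le_of_coeff_ne_zero hfirst hgap r hr j (hj.trans hi) hc),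
      hL]
  refine ⟨fun i hi => ?_, ?_⟩
  · rw [← hA i (by lia), map_sum]
    simp only [PowerSeries.coeff_mul_C, PowerSeries.coeff_X_pow]
    rw [Finset.sum_eq_single i]
    · simp
    · intro j _ hj
      rw [if_neg hj.symm, zero_mul]
    · intro h
      exact absurd (Finset.mem_range.2 (by lia)) h
  · rw [hA k le_rfl, mul_comm, PowerSeries.coeff_mul,
      Finset.Nat.sum_antidiagonal_eq_sum_range_succ_mk]
    refine Finset.sum_congr rfl fun j hj => ?_
    have hjk : j ≤ k := Nat.lt_succ_iff.1 (Finset.mem_range.1 hj)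
    have hsign : (-1 : ℝ) ^ (j + k) = (-1) ^ (k - j) := by
      rw [show j + k = (k - j) + 2 * j by lia, pow_add, pow_mul]
      simp
    rw [PowerSeries.coeff_mk, coeff_qPochhammer (NNReal.coe_pos.2 hq), hsign]
    ring
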